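/- Notation. Let $\mathbb T$ be the unit circle with its normalized Haar measure. For a complex Banach space $X$, let $\widetilde H^1(X)$ be the closure in $L^1(\mathbb T;X)$ of the set of $X$-valued analytic polynomials $\sum_{k=0}^n z^k x_k$ ($n\ge 0$, $x_k\in X$); for $X=\mathbb C$ this is the classical Hardy space $H^1=\widetilde H^1(\mathbb C)$. Let $H^1\hat\otimes X$ be the projective tensor product, i.e. the completion of $H^1\otimes X$ for the norm $\|u\|_\wedge=\inf\{\sum_k\|h_k\|\,\|x_k\| : u=\sum_k h_k\otimes x_k\}$ (finite sums), and let $H^1\hat\otimes X\to\widetilde H^1(X)$ be the canonical continuous linear map that sends $h\otimes x$ to the function $z\mapsto h(z)x$. The space $X$ is called $H^1$-projective if this canonical map is surjective. The $H^1$-projectivity constant $\eta(X)$ is the smallest constant $c\ge 0$ such that $\|F\|_{H^1\hat\otimes X}\le c\,\|F\|_{\widetilde H^1(X)}$ for all $F\in H^1\hat\otimes X$, where $\|F\|_{\widetilde H^1(X)}$ is the norm of the image of $F$ under the canonical map. For a family $(X_i)_{i\in I}$ of complex Banach spaces and an ultrafilter $\mathcal U$ on $I$, the ultraproduct $(\prod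 X_i)/\mathcal U$ is the quotient of $\ell^\infty(I,(X_i)_{i\in I})=\{(x_i)_{i\in I} : x_i\in X_i,\ \sup_i\|x_i\|<\infty\}$ by its closed subspace $\{(x_i)_{i\in I} : \lim_{\mathcal U}\|x_i\|=0\}$, with the quotient norm. Theorem 5.4. Let $(X_i)_{i\in I}$ be a family of $H^1$-projective complex Banach spaces such that $\sup\{\eta(X_i) : i\in I\}<+\infty$. Then for every ultrafilter $\mathcal U$ on $I$ the ultraproduct $(\prod X_i)/\mathcal U$ is $H^1$-projective. -/

import Mathlib

open MeasureTheory Filter Topology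
open scoped ENNReal NNReal TensorProduct

set_option linter.unusedSectionVars false

noncomputable section

/-! ### The projective tensor product of two complex Banach spaces -/

/-- The algebraic tensor product `X ⊗ Y`, as a type of its own which carries the projective norm. -/
def ProjTensor (X Y : Type*) [NormedAddCommGroup X] [NormedSpace ℂ X]
    [NormedAddCommGroup Y] [NormedSpace ℂ Y] : Type _ := X ⊗[ℂ] Y

namespace ProjTensor

variable {X Y : Type*} [NormedAddCommGroup X] [NormedSpace ℂ X]
  [NormedAddCommGroup Y] [NormedSpace ℂ Y]

instance : AddCommGroup (ProjTensor X Y) := inferInstanceAs (AddCommGroup (X ⊗[ℂ] Y))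

instance : Module ℂ (ProjTensor X Y) := inferInstanceAs (Module ℂ (X ⊗[ℂ] Y))

/-- The elementary tensor `x ⊗ y`. -/
def tmul (x : X) (y : Y) : ProjTensor X Y := x ⊗ₜ[ℂ] y

/-- `∑ₖ xₖ ⊗ yₖ` for a finite list of pairs `(xₖ, yₖ)`. -/
def tensorSum (l : List (X × Y)) : ProjTensor X Y := (l.map fun p => tmul p.1 p.2).sum

/-- `∑ₖ ‖xₖ‖ ‖yₖ‖` for a finite list of pairs `(xₖ, yₖ)`. -/
def cost (l : List (X × Y)) : ℝ := (l.map fun p => ‖p.1‖ * ‖p.2‖).sum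

/-- The projective tensor norm: the infimum of `∑ₖ ‖xₖ‖ ‖yₖ‖` over all the
representations `u = ∑ₖ xₖ ⊗ yₖ`. -/
def projNorm (u : ProjTensor X Y) : ℝ := sInf {r | ∃ l : List (X × Y), tensorSum l = u ∧ cost l = r}

lemma cost_nonneg (l : List (X × Y)) : 0 ≤ cost l := by
  refine List.sum_nonneg fun a ha => ?_
  obtain ⟨p, -, rfl⟩ := List.mem_map.1 ha
  positivity

lemma tensorSum_append (l m : List (X × Y)) :
    tensorSum (l ++ m) = tensorSum l + tensorSum m := by simp [tensorSum]

lemma cost_append (l m : List (X × Y)) : cost (l ++ m) = cost l + cost m := by simp [cost]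

lemma tensorSum_smul (c : ℂ) (l : List (X × Y)) :
    tensorSum (l.map fun p => (c • p.1, p.2)) = c • tensorSum l := by
  induction l with
  | nil => simp [tensorSum]
  | cons p l ih =>
    simp only [tensorSum, List.map_cons, List.sum_cons, smul_add] at ih ⊢
    rw [ih]
    congr 1

lemma cost_smul (c : ℂ) (l : List (X × Y)) :
    cost (l.map fun p => (c • p.1, p.2)) = ‖c‖ * cost l := by
  induction l with
  | nil => simp [cost]
  | cons p l ih =>
    simp only [cost, List.map_cons, List.sum_cons, mul_add, norm_smul] at ih ⊢
    rw [ih]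
    ring

lemma exists_tensorSum (u : ProjTensor X Y) : ∃ l : List (X × Y), tensorSum l = u := by
  refine TensorProduct.induction_on (motive := fun u : X ⊗[ℂ] Y =>
    ∃ l : List (X × Y), tensorSum l = (show ProjTensor X Y from u)) u ⟨[], rfl⟩ ?_ ?_
  · intro x y
    exact ⟨[(x, y)], add_zero (tmul x y)⟩
  · rintro a b ⟨l, hl⟩ ⟨m, hm⟩
    exact ⟨l ++ m, by rw [tensorSum_append, hl, hm]; rfl⟩

lemma bddBelow_costs (u : ProjTensor X Y) :
    BddBelow {r | ∃ l : List (X × Y), tensorSum l = u ∧ cost l = r} :=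
  ⟨0, by rintro r ⟨l, -, rfl⟩; exact cost_nonneg l⟩

lemma projNorm_le_cost (l : List (X × Y)) : projNorm (tensorSum l) ≤ cost l :=
  csInf_le (bddBelow_costs _) ⟨l, rfl, rfl⟩

lemma exists_cost_lt (u : ProjTensor X Y) {ε : ℝ} (hε : 0 < ε) :
    ∃ l : List (X × Y), tensorSum l = u ∧ cost l < projNorm u + ε := by
  obtain ⟨l₀, h₀⟩ := exists_tensorSum u
  obtain ⟨r, ⟨l, hl, rfl⟩, hr⟩ := exists_lt_of_csInf_lt
    (s := {r | ∃ l : List (X × Y), tensorSum l = u ∧ cost l = r}) ⟨_, l₀, h₀, rfl⟩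
    (lt_add_of_pos_right (projNorm u) hε)
  exact ⟨l, hl, hr⟩

lemma projNorm_zero : projNorm (0 : ProjTensor X Y) = 0 := by
  refine le_antisymm ?_ (Real.sInf_nonneg ?_)
  · simpa [tensorSum, cost] using projNorm_le_cost ([] : List (X × Y))
  · rintro r ⟨l, -, rfl⟩
    exact cost_nonneg l

lemma projNorm_add_le (u v : ProjTensor X Y) : projNorm (u + v) ≤ projNorm u + projNorm v := by
  refine le_of_forall_pos_le_add fun ε hε => ?_
  obtain ⟨l, rfl, hl⟩ := exists_cost_lt u (half_pos hε)
  obtain ⟨m, rfl, hm⟩ := exists_cost_lt v (half_pos hε)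
  have h := projNorm_le_cost (l ++ m)
  rw [tensorSum_append, cost_append] at h
  linarith

lemma projNorm_smul_le (c : ℂ) (u : ProjTensor X Y) : projNorm (c • u) ≤ ‖c‖ * projNorm u := by
  refine le_of_forall_pos_le_add fun ε hε => ?_
  obtain ⟨l, rfl, hl⟩ := exists_cost_lt u (ε := ε / (‖c‖ + 1)) (by positivity)
  have h := projNorm_le_cost (l.map fun p => (c • p.1, p.2))
  rw [tensorSum_smul, cost_smul] at h
  have h1 : ‖c‖ * cost l ≤ ‖c‖ * (projNorm (tensorSum l) + ε / (‖c‖ + 1)) := by gcongr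
  have h2 : ‖c‖ * (ε / (‖c‖ + 1)) ≤ ε := by
    rw [mul_div_assoc', div_le_iff₀ (by positivity)]
    nlinarith [norm_nonneg c]
  linarith

instance : SeminormedAddCommGroup (ProjTensor X Y) :=
  AddGroupSeminorm.toSeminormedAddCommGroup
    { toFun := projNorm
      map_zero' := projNorm_zero
      add_le' := projNorm_add_le
      neg' := fun u => by
        have key : ∀ v : ProjTensor X Y, projNorm (-v) ≤ projNorm v := fun v => by
          simpa using projNorm_smul_le (-1) v
        exact le_antisymm (key u) (by simpa using key (-u)) }

lemma norm_def (u : ProjTensor X Y) : ‖u‖ = projNorm u := rfl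

instance : NormedSpace ℂ (ProjTensor X Y) where
  norm_smul_le := projNorm_smul_le

end ProjTensor

/-- The projective tensor product `X ⊗̂ Y`: the completion of `X ⊗ Y` for the projective norm. -/
abbrev ProjTensorCompl (X Y : Type*) [NormedAddCommGroup X] [NormedSpace ℂ X]
    [NormedAddCommGroup Y] [NormedSpace ℂ Y] : Type _ :=
  UniformSpace.Completion (ProjTensor X Y)

/-! ### Vector valued Hardy spaces

The circle `𝕋` is `UnitAddCircle = ℝ / ℤ`, through `t ↦ exp (2πit)`; the character `fourier k`
is the function `z ↦ z ^ k`, and `haarAddCircle` is the normalized Haar measure. -/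

/-- `L¹(𝕋; X)`. -/
abbrev L1T (X : Type*) [NormedAddCommGroup X] : Type _ :=
  Lp X 1 (AddCircle.haarAddCircle : Measure UnitAddCircle)

section Hardy

variable {X : Type*} [NormedAddCommGroup X] [NormedSpace ℂ X]

/-- The function `z ↦ h(z) x` in `L¹(𝕋; X)`, for `h` in `L¹(𝕋)` and `x` in `X`. -/
def smulVec (h : L1T ℂ) (x : X) : L1T X :=
  (ContinuousLinearMap.toSpanSingleton ℂ x).compLpL 1 AddCircle.haarAddCircle h

lemma coeFn_smulVec (h : L1T ℂ) (x : X) :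
    smulVec h x =ᵐ[AddCircle.haarAddCircle] fun t => h t • x := by
  filter_upwards [(ContinuousLinearMap.toSpanSingleton ℂ x).coeFn_compLpL h] with t ht
  exact ht

lemma norm_smulVec_le (h : L1T ℂ) (x : X) : ‖smulVec h x‖ ≤ ‖h‖ * ‖x‖ := by
  have h1 := (ContinuousLinearMap.toSpanSingleton ℂ x).norm_compLp_le h
  rw [ContinuousLinearMap.norm_toSpanSingleton, mul_comm] at h1
  exact h1

/-- The monomial `z ↦ z ^ k x`, for `k ≥ 0`. -/
def monomialVec (k : ℕ) (x : X) : L1T X := smulVec (fourierLp 1 (k : ℤ)) x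

variable (X) in
/-- The space `𝒫₊(X)` of the `X`-valued analytic polynomials `∑ₖ z ^ k xₖ`, in `L¹(𝕋; X)`. -/
def analyticPoly : Submodule ℂ (L1T X) :=
  Submodule.span ℂ (Set.range fun p : ℕ × X => monomialVec p.1 p.2)

variable (X) in
/-- `H̃¹(X)`: the closure in `L¹(𝕋; X)` of the `X`-valued analytic polynomials. For `X = ℂ` this
is the classical Hardy space `H¹`, seen through its boundary values. -/
def hardyOne : Submodule ℂ (L1T X) := (analyticPoly X).topologicalClosure

instance [CompleteSpace X] : CompleteSpace (hardyOne X) :=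
  inferInstanceAs (CompleteSpace (analyticPoly X).topologicalClosure)

lemma smulVec_mem_hardyOne {h : L1T ℂ} (hh : h ∈ hardyOne ℂ) (x : X) :
    smulVec h x ∈ hardyOne X := by
  let T : L1T ℂ →L[ℂ] L1T X :=
    (ContinuousLinearMap.toSpanSingleton ℂ x).compLpL 1 AddCircle.haarAddCircle
  have hT : analyticPoly ℂ ≤ (analyticPoly X).comap T.toLinearMap := by
    refine Submodule.span_le.2 ?_
    rintro _ ⟨⟨k, a⟩, rfl⟩
    have : T (monomialVec k a) = monomialVec k (a • x) := by
      apply Lp.ext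
      filter_upwards [coeFn_smulVec (monomialVec k a) x, coeFn_smulVec (fourierLp 1 (k : ℤ)) a,
        coeFn_smulVec (fourierLp 1 (k : ℤ)) (a • x)] with t h1 h2 h3
      change (smulVec (monomialVec k a) x) t = _
      rw [h1, monomialVec, h2, monomialVec, h3, smul_eq_mul, mul_smul]
    exact Submodule.subset_span ⟨(k, a • x), this.symm⟩
  exact map_mem_closure T.continuous (s := (analyticPoly ℂ : Set (L1T ℂ))) hh fun g hg => hT hg

variable (X) in
/-- The bilinear map `(h, x) ↦ (z ↦ h(z) x)` from `H¹ × X` to `H̃¹(X)`. -/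
def hardyBilin : hardyOne ℂ →ₗ[ℂ] X →ₗ[ℂ] hardyOne X :=
  LinearMap.mk₂ ℂ (fun h x => ⟨smulVec h.1 x, smulVec_mem_hardyOne h.2 x⟩)
    (fun h h' x => Subtype.ext (map_add _ h.1 h'.1))
    (fun c h x => Subtype.ext (map_smul _ c h.1))
    (fun h x y => Subtype.ext <| Lp.ext <| by
      filter_upwards [coeFn_smulVec h.1 (x + y), coeFn_smulVec h.1 x, coeFn_smulVec h.1 y,
        Lp.coeFn_add (smulVec h.1 x) (smulVec h.1 y)] with t h1 h2 h3 h4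
      change smulVec h.1 (x + y) t = (smulVec h.1 x + smulVec h.1 y : L1T X) t
      rw [h4, Pi.add_apply, h1, h2, h3, smul_add])
    (fun c h x => Subtype.ext <| Lp.ext <| by
      filter_upwards [coeFn_smulVec h.1 (c • x), coeFn_smulVec h.1 x,
        Lp.coeFn_smul c (smulVec h.1 x)] with t h1 h2 h3
      change smulVec h.1 (c • x) t = (c • smulVec h.1 x : L1T X) t
      rw [h3, Pi.smul_apply, h1, h2, smul_comm])

variable (X) in
/-- The canonical map `H¹ ⊗ X → H̃¹(X)` on the algebraic tensor product. -/
def hardyInclAlg : ProjTensor (hardyOne ℂ) X →ₗ[ℂ] hardyOne X :=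
  TensorProduct.lift (hardyBilin X)

lemma hardyInclAlg_tmul (h : hardyOne ℂ) (x : X) :
    hardyInclAlg X (ProjTensor.tmul h x) = hardyBilin X h x :=
  TensorProduct.lift.tmul h x

lemma norm_hardyInclAlg_le (u : ProjTensor (hardyOne ℂ) X) : ‖hardyInclAlg X u‖ ≤ 1 * ‖u‖ := by
  have key : ∀ l : List (hardyOne ℂ × X),
      ‖hardyInclAlg X (ProjTensor.tensorSum l)‖ ≤ ProjTensor.cost l := by
    intro l
    induction l with
    | nil => simp [ProjTensor.tensorSum, ProjTensor.cost]
    | cons p l ih =>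
      simp only [ProjTensor.tensorSum, ProjTensor.cost, List.map_cons, List.sum_cons,
        map_add] at ih ⊢
      refine (norm_add_le _ _).trans (add_le_add ?_ ih)
      rw [hardyInclAlg_tmul]
      exact norm_smulVec_le p.1.1 p.2
  rw [one_mul]
  refine le_of_forall_pos_le_add fun ε hε => ?_
  obtain ⟨l, rfl, hl⟩ := ProjTensor.exists_cost_lt u hε
  exact (key l).trans hl.le

variable (X) in
/-- The canonical map `H¹ ⊗̂ X → H̃¹(X)`, the continuous extension of `h ⊗ x ↦ (z ↦ h(z) x)`. -/
def hardyIncl [CompleteSpace X] : ProjTensorCompl (hardyOne ℂ) X →L[ℂ] hardyOne X :=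
  ((hardyInclAlg X).mkContinuous 1 norm_hardyInclAlg_le).extend UniformSpace.Completion.toComplL

lemma hardyIncl_coe [CompleteSpace X] (u : ProjTensor (hardyOne ℂ) X) :
    hardyIncl X (u : ProjTensorCompl (hardyOne ℂ) X) = hardyInclAlg X u :=
  ContinuousLinearMap.extend_eq _ (e := UniformSpace.Completion.toComplL)
    UniformSpace.Completion.denseRange_coe
    (UniformSpace.Completion.isUniformInducing_coe _) u

variable (X) in
/-- A complex Banach space `X` is `H¹`-projective if the canonical map `H¹ ⊗̂ X → H̃¹(X)`
is surjective. -/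
def IsH1Projective [CompleteSpace X] : Prop := Function.Surjective (hardyIncl X)

variable (X) in
/-- The `H¹`-projectivity constant `η(X)`: the smallest `c` such that `‖F‖ ≤ c ‖F‖_{H̃¹(X)}` for all
`F` in `H¹ ⊗̂ X` (and `∞` if there is no such `c`). -/
def h1ProjConst [CompleteSpace X] : ℝ≥0∞ :=
  sInf {c : ℝ≥0∞ | ∃ r : ℝ≥0, c = r ∧
    ∀ F : ProjTensorCompl (hardyOne ℂ) X, ‖F‖ ≤ r * ‖hardyIncl X F‖}

end Hardy

/-! ### Ultraproducts of Banach spaces -/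

section Ultraproduct

variable {ι : Type*} (U : Ultrafilter ι) (X : ι → Type*) [∀ i, NormedAddCommGroup (X i)]
  [∀ i, NormedSpace ℂ (X i)]

/-- The subspace `N_U` of the bounded families `x` with `lim_U ‖xᵢ‖ = 0`. -/
def ultraNull : Submodule ℂ (lp X ∞) where
  carrier := {x | Tendsto (fun i => ‖x i‖) (U : Filter ι) (𝓝 0)}
  add_mem' := by
    intro x y hx hy
    refine squeeze_zero (fun i => norm_nonneg _) (fun i => ?_) (by simpa using hx.add hy)
    rw [lp.coeFn_add]
    exact norm_add_le _ _
  zero_mem' := by simp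
  smul_mem' := by
    intro c x hx
    refine squeeze_zero (fun i => norm_nonneg _) (fun i => ?_) (by simpa using hx.const_mul ‖c‖)
    rw [lp.coeFn_smul, Pi.smul_apply, norm_smul]

instance isClosed_ultraNull : IsClosed (ultraNull U X : Set (lp X ∞)) := by
  refine isClosed_of_closure_subset fun x hx => ?_
  change Tendsto (fun i => ‖x i‖) (U : Filter ι) (𝓝 0)
  rw [Metric.tendsto_nhds]
  intro ε hε
  obtain ⟨y, hy, hxy⟩ := Metric.mem_closure_iff.1 hx (ε / 2) (half_pos hε)
  filter_upwards [Metric.tendsto_nhds.1 (show Tendsto (fun i => ‖y i‖) (U : Filter ι) (𝓝 0) from hy)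
    (ε / 2) (half_pos hε)] with i hi
  have h1 : ‖x i - y i‖ ≤ ‖x - y‖ := by
    simpa using lp.norm_apply_le_norm ENNReal.top_ne_zero (x - y) i
  rw [dist_eq_norm] at hxy
  rw [dist_zero_right, norm_norm] at hi ⊢
  have h2 := norm_le_norm_add_norm_sub' (x i) (y i)
  linarith

/-- The ultraproduct `(∏ Xᵢ) / U`: the quotient of `ℓ^∞(I, (Xᵢ))` by `N_U`, with the
quotient norm. -/
abbrev Ultraprod : Type _ := lp X ∞ ⧸ ultraNull U X

end Ultraproduct

end

/-! By density and completeness it suffices to lift analytic polynomials with values in the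
ultraproduct to `H¹ ⊗ X` with a linear bound on the norm (`isH1Projective_of_forall_analyticPoly`).
Lift the coefficients of such a polynomial to bounded families. Since the circle is compact, the
`L¹` norms of the component polynomials exceed that of the given one by at most `ε` for `U`-almost
all `i` (`eventually_norm_sum_monomialVec_le`), so the bound on the constants `η(Xᵢ)` controls their
projective norms.

The difficulty is to return to the ultraproduct: near-optimal representations in `H¹ ⊗ Xᵢ` may have
unboundedly many terms, with functions that vary with `i`. A finite rank contraction `V` of `H¹`
cures this. A finite net in the unit ball of its range gives fixed vectors `e m` on which every
representation can be rewritten, at the price of a factor 2; the coefficients are then finitely many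
bounded families, and these define elements of the ultraproduct (`norm_sum_tmul_mk_ultraNull_le`).
With the Fejér means as `V`, the bound does not depend on their order `N`, and they converge to the
identity on monomials, which removes `V` (`norm_sum_hardyMonomial_tmul_le`). -/

/-! ### The ultraproduct norm as a limit along the ultrafilter. -/

theorem norm_mk_ultraNull_le {ι : Type*} (U : Ultrafilter ι) (X : ι → Type*)
    [∀ i, NormedAddCommGroup (X i)] [∀ i, NormedSpace ℂ (X i)] (x : lp X ∞) {C : ℝ} (hC : 0 ≤ C)
    (h : ∀ᶠ i in (U : Filter ι), ‖x i‖ ≤ C) :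
    ‖(Submodule.Quotient.mk x : Ultraprod U X)‖ ≤ C := by
  classical
  -- Discarding the large components changes `x` only off a `U`-large set, hence not its class.
  let y : ∀ i, X i := fun i => if ‖x i‖ ≤ C then x i else 0
  have hy : ∀ i, ‖y i‖ ≤ C := by
    intro i
    by_cases hi : ‖x i‖ ≤ C <;> simp [y, hi, hC]
  let z : lp X ∞ := ⟨y, memℓp_infty ⟨C, by rintro _ ⟨i, rfl⟩; exact hy i⟩⟩
  have hz : ‖z‖ ≤ C := lp.norm_le_of_forall_le hC hy
  have hxz : (Submodule.Quotient.mk x : Ultraprod U X) = Submodule.Quotient.mk z := by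
    rw [Submodule.Quotient.eq]
    change Tendsto (fun i => ‖(x - z) i‖) (U : Filter ι) (𝓝 0)
    refine tendsto_const_nhds.congr' ?_
    filter_upwards [h] with i hi
    have : (x - z) i = 0 := by
      rw [lp.coeFn_sub, Pi.sub_apply, sub_eq_zero]
      change x i = if ‖x i‖ ≤ C then x i else 0
      rw [if_pos hi]
    rw [this, norm_zero]
  rw [hxz]
  exact (Submodule.Quotient.norm_mk_le _ z).trans hz

theorem eventually_norm_apply_le_norm_mk_ultraNull {ι : Type*} (U : Ultrafilter ι) (X : ι → Type*)
    [∀ i, NormedAddCommGroup (X i)] [∀ i, NormedSpace ℂ (X i)] (x : lp X ∞) {ε : ℝ} (hε : 0 < ε) :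
    ∀ᶠ i in (U : Filter ι), ‖x i‖ ≤ ‖(Submodule.Quotient.mk x : Ultraprod U X)‖ + ε := by
  obtain ⟨y, hy, hlt⟩ := Submodule.Quotient.norm_mk_lt
    (Submodule.Quotient.mk x : Ultraprod U X) (half_pos hε)
  have hxy : Tendsto (fun i => ‖(y - x) i‖) (U : Filter ι) (𝓝 0) :=
    (Submodule.Quotient.eq (ultraNull U X)).1 hy
  filter_upwards [hxy.eventually_lt_const (half_pos hε)] with i hi
  rw [lp.coeFn_sub, Pi.sub_apply] at hi
  have h1 := lp.norm_apply_le_norm ENNReal.top_ne_zero y i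
  have h2 := norm_le_norm_add_norm_sub (y i) (x i)
  linarith

theorem tendsto_norm_apply_norm_mk_ultraNull {ι : Type*} (U : Ultrafilter ι) (X : ι → Type*)
    [∀ i, NormedAddCommGroup (X i)] [∀ i, NormedSpace ℂ (X i)] (x : lp X ∞) :
    Tendsto (fun i => ‖x i‖) (U : Filter ι)
      (𝓝 ‖(Submodule.Quotient.mk x : Ultraprod U X)‖) := by
  refine tendsto_order.2 ⟨fun a ha => ?_, fun a ha => ?_⟩
  · by_contra hcon
    have h : ∀ᶠ i in (U : Filter ι), ‖x i‖ ≤ a := by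
      filter_upwards [Ultrafilter.eventually_not.2 hcon] with i hi using not_lt.1 hi
    obtain ⟨i, hi⟩ := h.exists
    exact absurd (norm_mk_ultraNull_le U X x ((norm_nonneg _).trans hi) h) (not_le.2 ha)
  · filter_upwards [eventually_norm_apply_le_norm_mk_ultraNull U X x
      (half_pos (sub_pos.2 ha))] with i hi
    linarith

/-- On a compact set of bounded families, the norms of the components are uniformly controlled by
the norm in the ultraproduct. -/
theorem IsCompact.eventually_norm_apply_le_norm_mk_ultraNull {ι : Type*} (U : Ultrafilter ι)
    (X : ι → Type*) [∀ i, NormedAddCommGroup (X i)] [∀ i, NormedSpace ℂ (X i)] {K : Set (lp X ∞)}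
    (hK : IsCompact K) {ε : ℝ} (hε : 0 < ε) :
    ∀ᶠ i in (U : Filter ι), ∀ x ∈ K,
      ‖x i‖ ≤ ‖(Submodule.Quotient.mk x : Ultraprod U X)‖ + ε := by
  -- Three errors of `ε / 3`: from `x i` to `y i` at a centre `y`, the bound at `y`, and back from
  -- the class of `y` to that of `x`.
  obtain ⟨t, -, ht, hcov⟩ := hK.finite_cover_balls (e := ε / 3) (by positivity)
  have h := (ht.eventually_all (l := (U : Filter ι))).2 fun y _ =>
    _root_.eventually_norm_apply_le_norm_mk_ultraNull U X y (ε := ε / 3) (by positivity)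
  filter_upwards [h] with i hi x hx
  obtain ⟨y, hy, hxy⟩ := Set.mem_iUnion₂.1 (hcov hx)
  rw [Metric.mem_ball, dist_eq_norm] at hxy
  have h1 : ‖x i - y i‖ ≤ ‖x - y‖ := by
    simpa using lp.norm_apply_le_norm ENNReal.top_ne_zero (x - y) i
  have h2 := norm_le_norm_add_norm_sub' (x i) (y i)
  have h3 : ‖(Submodule.Quotient.mk y : Ultraprod U X)‖
      ≤ ‖(Submodule.Quotient.mk x : Ultraprod U X)‖ + ‖x - y‖ := by
    have h4 := norm_le_norm_add_norm_sub (Submodule.Quotient.mk x : Ultraprod U X)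
      (Submodule.Quotient.mk y)
    rw [← Submodule.Quotient.mk_sub] at h4
    linarith [Submodule.Quotient.norm_mk_le (ultraNull U X) (x - y)]
  linarith [hi y hy]

/-! ### Analytic polynomials and their `L¹` norms. -/

theorem coeFn_sum_monomialVec {X : Type*} [NormedAddCommGroup X] [NormedSpace ℂ X] {J : Type*}
    (s : Finset J) (d : J → ℕ) (x : J → X) :
    (∑ j ∈ s, monomialVec (d j) (x j) : L1T X) =ᵐ[AddCircle.haarAddCircle]
      fun t => ∑ j ∈ s, fourier (d j : ℤ) t • x j := by
  have h : ∀ j, monomialVec (d j) (x j) =ᵐ[AddCircle.haarAddCircle]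
      fun t => fourier (d j : ℤ) t • x j := by
    intro j
    filter_upwards [coeFn_smulVec (fourierLp 1 (d j : ℤ)) (x j),
      coeFn_fourierLp 1 (d j : ℤ)] with t h1 h2
    rw [monomialVec, h1, h2]
  have hall := (s.eventually_all (l := ae AddCircle.haarAddCircle)).2 fun j _ => h j
  filter_upwards [Lp.coeFn_finsetSum s fun j => monomialVec (d j) (x j), hall] with t h1 h2
  rw [h1, Finset.sum_apply]
  exact Finset.sum_congr rfl h2

theorem norm_sum_monomialVec {X : Type*} [NormedAddCommGroup X] [NormedSpace ℂ X] {J : Type*}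
    (s : Finset J) (d : J → ℕ) (x : J → X) :
    ‖(∑ j ∈ s, monomialVec (d j) (x j) : L1T X)‖
      = ∫ t, ‖∑ j ∈ s, fourier (d j : ℤ) t • x j‖ ∂(AddCircle.haarAddCircle : Measure UnitAddCircle)
      := by
  rw [L1.norm_eq_integral_norm]
  refine integral_congr_ae ?_
  filter_upwards [coeFn_sum_monomialVec s d x] with t ht
  rw [ht]

/-- One set of indices must serve all points of the circle. It exists because the lifted polynomial
`g` is continuous into `ℓ^∞`, so that its range is compact; the pointwise bound is then integrated
against a probability measure. -/
theorem eventually_norm_sum_monomialVec_le {ι : Type*} (U : Ultrafilter ι) (X : ι → Type*)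
    [∀ i, NormedAddCommGroup (X i)] [∀ i, NormedSpace ℂ (X i)] {J : Type*} (s : Finset J)
    (d : J → ℕ) (x : J → lp X ∞) {ε : ℝ} (hε : 0 < ε) :
    ∀ᶠ i in (U : Filter ι), ‖(∑ j ∈ s, monomialVec (d j) (x j i) : L1T (X i))‖
      ≤ ‖(∑ j ∈ s, monomialVec (d j) (Submodule.Quotient.mk (x j)) : L1T (Ultraprod U X))‖ + ε := by
  let g : UnitAddCircle → lp X ∞ := fun t => ∑ j ∈ s, fourier (d j : ℤ) t • x j
  have hg : Continuous g := by fun_prop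
  filter_upwards [(isCompact_range hg).eventually_norm_apply_le_norm_mk_ultraNull U X hε] with i hi
  have hi' : ∀ t : UnitAddCircle, ‖∑ j ∈ s, fourier (d j : ℤ) t • x j i‖ ≤
      ‖∑ j ∈ s, fourier (d j : ℤ) t • (Submodule.Quotient.mk (x j) : Ultraprod U X)‖ + ε := by
    intro t
    have h1 := hi (g t) ⟨t, rfl⟩
    have h2 : (g t) i = ∑ j ∈ s, fourier (d j : ℤ) t • x j i := by
      simp only [g, lp.coeFn_sum, lp.coeFn_smul, Finset.sum_apply, Pi.smul_apply]
    have h3 : (Submodule.Quotient.mk (g t) : Ultraprod U X)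
        = ∑ j ∈ s, fourier (d j : ℤ) t • (Submodule.Quotient.mk (x j) : Ultraprod U X) := by
      change (ultraNull U X).mkQ (g t) = _
      simp only [g, map_sum, map_smul]
      rfl
    rwa [h2, h3] at h1
  rw [norm_sum_monomialVec, norm_sum_monomialVec]
  refine (integral_mono (g := fun t : UnitAddCircle => ‖∑ j ∈ s, fourier (d j : ℤ) t •
    (Submodule.Quotient.mk (x j) : Ultraprod U X)‖ + ε) ?_ ?_ hi').trans ?_
  · exact Continuous.integrable_of_hasCompactSupport (by fun_prop)
      (HasCompactSupport.of_compactSpace _)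
  · exact Continuous.integrable_of_hasCompactSupport (by fun_prop)
      (HasCompactSupport.of_compactSpace _)
  · rw [integral_add]
    · simp
    · exact Continuous.integrable_of_hasCompactSupport (by fun_prop)
        (HasCompactSupport.of_compactSpace _)
    · exact integrable_const _

-- Finite rank contractions and projective norms.

universe u

/-- In a finite dimensional space, finitely many vectors of the unit ball generate all the vectors
with coefficients whose sum is at most twice the norm. -/
theorem exists_fintype_sum_smul_eq_norm_le (E : Type u) [NormedAddCommGroup E] [NormedSpace ℂ E]
    [FiniteDimensional ℂ E] :
    ∃ (κ : Type u) (_ : Fintype κ) (e : κ → E) (a : E → κ → ℂ), (∀ m, ‖e m‖ ≤ 1) ∧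
      ∀ v, ∑ m, a v m • e m = v ∧ ∑ m, ‖a v m‖ ≤ 2 * ‖v‖ := by
  classical
  have : ProperSpace E := FiniteDimensional.proper ℂ E
  let b := Module.finBasis ℂ E
  let φ : Fin (Module.finrank ℂ E) → E →L[ℂ] ℂ := fun k => (b.coord k).toContinuousLinearMap
  have hφ : ∀ v, ∑ k, φ k v • b k = v := b.sum_repr
  let L : ℝ := ∑ k, ‖φ k‖ * ‖b k‖
  have hL : 0 ≤ L := Finset.sum_nonneg fun k _ => by positivity
  -- The mesh is chosen so that the error, of norm at most `‖v‖ / (L + 1)`, costs at most `‖v‖` when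
  -- expanded in the normalized basis, whose expansion constant is `L`.
  obtain ⟨t, hts, ht, hcov⟩ := (isCompact_closedBall (0 : E) 1).finite_cover_balls
    (e := 1 / (L + 1)) (by positivity)
  have : Fintype t := ht.fintype
  have key : ∀ v : E, ∃ c : t ⊕ Fin (Module.finrank ℂ E) → ℂ,
      ∑ m, c m • Sum.elim (fun x : t => (x : E)) (fun k => ((‖b k‖⁻¹ : ℝ) : ℂ) • b k) m = v ∧
      ∑ m, ‖c m‖ ≤ 2 * ‖v‖ := by
    intro v
    rcases eq_or_ne v 0 with rfl | hv
    · exact ⟨0, by simp, by simp⟩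
    have hv' : 0 < ‖v‖ := norm_pos_iff.2 hv
    have hu : ((‖v‖⁻¹ : ℝ) : ℂ) • v ∈ Metric.closedBall (0 : E) 1 := by
      rw [mem_closedBall_zero_iff, norm_smul, Complex.norm_real, norm_inv, norm_norm,
        inv_mul_cancel₀ hv'.ne']
    obtain ⟨x, hx, hvx⟩ := Set.mem_iUnion₂.1 (hcov hu)
    set w : E := v - (‖v‖ : ℂ) • x with hw
    have hwn : ‖w‖ ≤ ‖v‖ * (1 / (L + 1)) := by
      have : w = (‖v‖ : ℂ) • (((‖v‖⁻¹ : ℝ) : ℂ) • v - x) := by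
        rw [smul_sub, smul_smul, ← Complex.ofReal_mul, mul_inv_cancel₀ hv'.ne', Complex.ofReal_one,
          one_smul]
      rw [this, norm_smul, Complex.norm_real, norm_norm]
      rw [Metric.mem_ball, dist_eq_norm] at hvx
      gcongr
    -- Weight `‖v‖` on the net point `x`, and the coordinates of the error `w`, rescaled because the
    -- basis vectors are normalized.
    refine ⟨Sum.elim (Pi.single ⟨x, hx⟩ (‖v‖ : ℂ)) (fun k => φ k w * (‖b k‖ : ℂ)), ?_, ?_⟩
    · rw [Fintype.sum_sum_type]
      simp only [Sum.elim_inl, Sum.elim_inr]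
      rw [Finset.sum_eq_single (⟨x, hx⟩ : t) (fun y _ hy => by simp [Pi.single_eq_of_ne hy])
        (fun h => absurd (Finset.mem_univ _) h), Pi.single_eq_same]
      have h1 : ∀ k, (φ k w * (‖b k‖ : ℂ)) • ((‖b k‖⁻¹ : ℝ) : ℂ) • b k = φ k w • b k := by
        intro k
        rw [smul_smul, mul_assoc, ← Complex.ofReal_mul,
          mul_inv_cancel₀ (norm_ne_zero_iff.2 (b.ne_zero k)), Complex.ofReal_one, mul_one]
      rw [Finset.sum_congr rfl fun k _ => h1 k, hφ, hw, add_sub_cancel]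
    · rw [Fintype.sum_sum_type]
      simp only [Sum.elim_inl, Sum.elim_inr]
      rw [Finset.sum_eq_single (⟨x, hx⟩ : t) (fun y _ hy => by simp [Pi.single_eq_of_ne hy])
        (fun h => absurd (Finset.mem_univ _) h), Pi.single_eq_same, Complex.norm_real, norm_norm]
      have h2 : ∑ k, ‖φ k w * (‖b k‖ : ℂ)‖ ≤ L * ‖w‖ := by
        rw [Finset.sum_mul]
        refine Finset.sum_le_sum fun k _ => ?_
        rw [norm_mul, Complex.norm_real, norm_norm, mul_right_comm]
        gcongr
        exact (φ k).le_opNorm w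
      have h3 : L * ‖w‖ ≤ ‖v‖ := by
        refine (mul_le_mul_of_nonneg_left hwn hL).trans ?_
        rw [mul_one_div, mul_div_assoc', div_le_iff₀ (by positivity)]
        nlinarith
      linarith
  choose a ha using key
  refine ⟨_, inferInstance, _, a, ?_, ha⟩
  rintro (x | k)
  · exact mem_closedBall_zero_iff.1 (hts x.2)
  · simp [norm_smul, inv_mul_cancel₀ (norm_ne_zero_iff.2 (b.ne_zero k))]

namespace ProjTensor

variable {H X : Type*} [NormedAddCommGroup H] [NormedSpace ℂ H]
  [NormedAddCommGroup X] [NormedSpace ℂ X]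

/-- The bilinear map `(h, x) ↦ h ⊗ x`. -/
def tmulBilin : H →ₗ[ℂ] X →ₗ[ℂ] ProjTensor H X := TensorProduct.mk ℂ H X

theorem tmulBilin_apply (h : H) (x : X) : tmulBilin h x = tmul h x := rfl

theorem norm_tmul_le (h : H) (x : X) : ‖tmul h x‖ ≤ ‖h‖ * ‖x‖ := by
  simpa [tensorSum, cost, norm_def] using projNorm_le_cost [(h, x)]

theorem norm_sum_tmul_le {κ : Type*} (s : Finset κ) (h : κ → H) (x : κ → X) :
    ‖∑ m ∈ s, tmul (h m) (x m)‖ ≤ ∑ m ∈ s, ‖h m‖ * ‖x m‖ :=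
  norm_sum_le_of_le _ fun _ _ => norm_tmul_le _ _

/-- Reduces equality of two tensors with first factors in `E` to equality of their contractions by
the coordinate forms of `E`. -/
theorem sum_tmul_coe_eq_sum_finBasis {E : Submodule ℂ H} [FiniteDimensional ℂ E] {K : Type*}
    (s : Finset K) (v : K → E) (x : K → X) :
    ∑ k ∈ s, tmul (v k : H) (x k) = ∑ r, tmul (Module.finBasis ℂ E r : H)
      (∑ k ∈ s, (Module.finBasis ℂ E).coord r (v k) • x k) := by
  simp only [← tmulBilin_apply, map_sum, map_smul]
  rw [Finset.sum_comm]
  refine Finset.sum_congr rfl fun k _ => ?_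
  have h := congrArg (fun z : E => tmulBilin (z : H) (x k))
    ((Module.finBasis ℂ E).sum_repr (v k)).symm
  simp only [Submodule.coe_sum, Submodule.coe_smul, map_sum, map_smul, LinearMap.sum_apply,
    LinearMap.smul_apply] at h
  exact h

/-- A linear form on the first factor gives a map `H ⊗ X → X`. -/
def contract (φ : H →ₗ[ℂ] ℂ) : ProjTensor H X →ₗ[ℂ] X :=
  TensorProduct.lift (LinearMap.lsmul ℂ X ∘ₗ φ)

theorem contract_tmul (φ : H →ₗ[ℂ] ℂ) (h : H) (x : X) : contract φ (tmul h x) = φ h • x :=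
  TensorProduct.lift.tmul h x

/-- A finite rank contraction maps the tensors of small norm to tensors with a representation of
small cost whose number of terms only depends on the contraction. -/
theorem exists_contract_eq_sum {κ : Type*} [Fintype κ] {E : Type*} [NormedAddCommGroup E]
    [NormedSpace ℂ E] (V : H →ₗ[ℂ] E) (hV : ∀ h, ‖V h‖ ≤ ‖h‖) (e : κ → E) (a : E → κ → ℂ)
    (ha : ∀ v, ∑ m, a v m • e m = v ∧ ∑ m, ‖a v m‖ ≤ 2 * ‖v‖)
    (u : ProjTensor H X) {C : ℝ} (hu : ‖u‖ < C) :
    ∃ w : κ → X, ∑ m, ‖w m‖ ≤ 2 * C ∧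
      ∀ φ : E →ₗ[ℂ] ℂ, contract (φ ∘ₗ V) u = ∑ m, φ (e m) • w m := by
  obtain ⟨l, rfl, hl⟩ := exists_cost_lt u (sub_pos.2 hu)
  have hl' : cost l < C := by rw [norm_def] at hl; linarith
  suffices h : ∃ w : κ → X, ∑ m, ‖w m‖ ≤ 2 * cost l ∧
      ∀ φ : E →ₗ[ℂ] ℂ, contract (φ ∘ₗ V) (tensorSum l) = ∑ m, φ (e m) • w m by
    obtain ⟨w, h1, h2⟩ := h
    exact ⟨w, by linarith, h2⟩
  -- With the bound in terms of `cost l`, the claim is additive over the list and induction applies.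
  clear hl hl' hu
  induction l with
  | nil => exact ⟨0, by simp [cost], by simp [tensorSum]⟩
  | cons p l ih =>
    obtain ⟨w, h1, h2⟩ := ih
    -- Expanding `V p.1` on the `e m` moves its coefficients to the second factor `p.2`.
    refine ⟨fun m => a (V p.1) m • p.2 + w m, ?_, fun φ => ?_⟩
    · have h3 : ∑ m, ‖a (V p.1) m • p.2 + w m‖ ≤ ∑ m, (‖a (V p.1) m‖ * ‖p.2‖ + ‖w m‖) :=
        Finset.sum_le_sum fun m _ => (norm_add_le _ _).trans_eq (by rw [norm_smul])
      rw [Finset.sum_add_distrib, ← Finset.sum_mul] at h3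
      have h4 : (∑ m, ‖a (V p.1) m‖) * ‖p.2‖ ≤ 2 * ‖p.1‖ * ‖p.2‖ := by
        gcongr
        exact (ha _).2.trans (by linarith [hV p.1])
      simp only [cost, List.map_cons, List.sum_cons] at h1 ⊢
      linarith
    · have h3 := h2 φ
      have h4 : φ (V p.1) = ∑ m, a (V p.1) m * φ (e m) := by
        conv_lhs => rw [← (ha (V p.1)).1]
        simp
      simp only [tensorSum, List.map_cons, List.sum_cons, map_add, contract_tmul] at h3 ⊢
      rw [h3, LinearMap.comp_apply, h4, Finset.sum_smul, ← Finset.sum_add_distrib]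
      refine Finset.sum_congr rfl fun m _ => ?_
      rw [smul_add, smul_smul, mul_comm]

end ProjTensor

/-- Uniform bounds of projective norms pass to the ultraproduct through finite rank contractions. -/
theorem norm_sum_tmul_mk_ultraNull_le {ι : Type*} (U : Ultrafilter ι) (X : ι → Type*)
    [∀ i, NormedAddCommGroup (X i)] [∀ i, NormedSpace ℂ (X i)] {H : Type*} [NormedAddCommGroup H]
    [NormedSpace ℂ H] (V : H →ₗ[ℂ] H) (hV : ∀ h, ‖V h‖ ≤ ‖h‖)
    [FiniteDimensional ℂ (LinearMap.range V)] {J : Type*} (s : Finset J) (g : J → H)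
    (x : J → lp X ∞) {C : ℝ} (hC : 0 ≤ C)
    (h : ∀ᶠ i in (U : Filter ι), ‖∑ j ∈ s, ProjTensor.tmul (g j) (x j i)‖ < C) :
    ‖∑ j ∈ s, ProjTensor.tmul (V (g j)) (Submodule.Quotient.mk (x j) : Ultraprod U X)‖
      ≤ 2 * C := by
  classical
  obtain ⟨κ, _, e, a, he, ha⟩ := exists_fintype_sum_smul_eq_norm_le (LinearMap.range V)
  have hw : ∀ i, ∃ w : κ → X i, ∑ m, ‖w m‖ ≤ 2 * C ∧
      (‖∑ j ∈ s, ProjTensor.tmul (g j) (x j i)‖ < C → ∀ φ : LinearMap.range V →ₗ[ℂ] ℂ,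
        ProjTensor.contract (φ ∘ₗ V.rangeRestrict) (∑ j ∈ s, ProjTensor.tmul (g j) (x j i))
          = ∑ m, φ (e m) • w m) := by
    intro i
    by_cases hi : ‖∑ j ∈ s, ProjTensor.tmul (g j) (x j i)‖ < C
    · obtain ⟨w, h1, h2⟩ := ProjTensor.exists_contract_eq_sum V.rangeRestrict hV e a ha _ hi
      exact ⟨w, h1, fun _ => h2⟩
    -- The default 0 on the exceptional indices keeps the bound valid for every `i`, so each `W m`
    -- is a bounded family.
    · exact ⟨0, by simpa using hC, fun h' => absurd h' hi⟩
  choose w hwC hwφ using hw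
  have hwm : ∀ (m : κ) (i : ι), ‖w i m‖ ≤ 2 * C := fun m i =>
    (Finset.single_le_sum (f := fun m => ‖w i m‖) (fun _ _ => norm_nonneg _)
      (Finset.mem_univ m)).trans (hwC i)
  let W : κ → lp X ∞ := fun m => ⟨fun i => w i m, memℓp_infty ⟨2 * C, by
    rintro _ ⟨i, rfl⟩; exact hwm m i⟩⟩
  -- The index set `κ` is independent of `i`, so the bound on the whole sum passes to the limit
  -- along `U`.
  have hsum : ∑ m, ‖(Submodule.Quotient.mk (W m) : Ultraprod U X)‖ ≤ 2 * C := by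
    refine le_of_tendsto (tendsto_finsetSum _ fun m _ =>
      tendsto_norm_apply_norm_mk_ultraNull U X (W m)) ?_
    exact Eventually.of_forall hwC
  have hφ : ∀ φ : LinearMap.range V →ₗ[ℂ] ℂ,
      ∑ j ∈ s, φ (V.rangeRestrict (g j)) • (Submodule.Quotient.mk (x j) : Ultraprod U X)
        = ∑ m, φ (e m) • (Submodule.Quotient.mk (W m) : Ultraprod U X) := by
    intro φ
    have h1 : (ultraNull U X).mkQ (∑ j ∈ s, φ (V.rangeRestrict (g j)) • x j)
        = (ultraNull U X).mkQ (∑ m, φ (e m) • W m) := by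
      refine (Submodule.Quotient.eq _).2 ?_
      change Tendsto (fun i => ‖_‖) (U : Filter ι) (𝓝 0)
      refine tendsto_const_nhds.congr' ?_
      filter_upwards [h] with i hi
      have h2 := hwφ i hi φ
      simp only [map_sum, ProjTensor.contract_tmul, LinearMap.comp_apply] at h2
      have h3 : ((∑ j ∈ s, φ (V.rangeRestrict (g j)) • x j : lp X ∞) - ∑ m, φ (e m) • W m) i
          = ∑ j ∈ s, φ (V.rangeRestrict (g j)) • x j i - ∑ m, φ (e m) • w i m := by
        simp only [lp.coeFn_sub, lp.coeFn_sum, lp.coeFn_smul, Pi.sub_apply, Finset.sum_apply,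
          Pi.smul_apply]
        rfl
      rw [h3, h2, sub_self, norm_zero]
    simp only [map_sum, map_smul] at h1
    exact h1
  have heq : ∑ j ∈ s, ProjTensor.tmul (V (g j)) (Submodule.Quotient.mk (x j) : Ultraprod U X)
      = ∑ m, ProjTensor.tmul (e m : H) (Submodule.Quotient.mk (W m) : Ultraprod U X) := by
    have h1 := ProjTensor.sum_tmul_coe_eq_sum_finBasis s (fun j => V.rangeRestrict (g j))
      (fun j => (Submodule.Quotient.mk (x j) : Ultraprod U X))
    have h2 := ProjTensor.sum_tmul_coe_eq_sum_finBasis Finset.univ e (fun m => (Submodule.Quotient.mk (W m) : Ultraprod U X))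
    rw [h2]
    refine h1.trans (Finset.sum_congr rfl fun r _ => ?_)
    rw [hφ]
  rw [heq]
  refine (ProjTensor.norm_sum_tmul_le _ _ _).trans (le_trans ?_ hsum)
  exact Finset.sum_le_sum fun m _ => mul_le_of_le_one_left (norm_nonneg _) (he m)

/-! ### Fejér means on `L¹` and `H¹`. -/

theorem integral_fourier (n : ℤ) :
    ∫ t, fourier n t ∂(AddCircle.haarAddCircle : Measure UnitAddCircle) = if n = 0 then 1 else 0 := by
  split_ifs with h
  · simp [h]
  · exact integral_eq_zero_of_add_right_eq_neg (μ := AddCircle.haarAddCircle)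
      (fourier_add_half_inv_index h (T := 1) one_pos)

/-- The Fejér kernel, as the normalized square of the modulus of the Dirichlet type sum
`∑_{j < N} z ^ j`. -/
noncomputable def fejerKernel (N : ℕ) (t : UnitAddCircle) : ℝ :=
  (N : ℝ)⁻¹ * ‖∑ j ∈ Finset.range N, fourier (j : ℤ) t‖ ^ 2

theorem fejerKernel_nonneg (N : ℕ) (t : UnitAddCircle) : 0 ≤ fejerKernel N t := by
  unfold fejerKernel; positivity

theorem continuous_fejerKernel (N : ℕ) : Continuous (fejerKernel N) := by
  unfold fejerKernel; fun_prop

theorem integrable_fejerKernel (N : ℕ) :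
    Integrable (fejerKernel N) (AddCircle.haarAddCircle : Measure UnitAddCircle) :=
  (continuous_fejerKernel N).integrable_of_hasCompactSupport (HasCompactSupport.of_compactSpace _)

theorem ofReal_fejerKernel (N : ℕ) (t : UnitAddCircle) :
    (fejerKernel N t : ℂ) = (N : ℂ)⁻¹ * ∑ j ∈ Finset.range N, ∑ l ∈ Finset.range N,
      fourier ((j : ℤ) - l) t := by
  rw [fejerKernel]
  push_cast
  rw [← Complex.mul_conj', map_sum, Finset.sum_mul_sum]
  congr 1
  refine Finset.sum_congr rfl fun j _ => Finset.sum_congr rfl fun l _ => ?_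
  rw [← fourier_neg, ← fourier_add, sub_eq_add_neg]

theorem integrable_fourier (n : ℤ) :
    Integrable (fun t => fourier n t) (AddCircle.haarAddCircle : Measure UnitAddCircle) :=
  (map_continuous (fourier n)).integrable_of_hasCompactSupport
    (HasCompactSupport.of_compactSpace _)

/-- Only the diagonal `j = l` contributes, for a total of `N⁻¹ * N`; this is 0 when `N = 0`, hence
the inequality. -/
theorem integral_fejerKernel_le (N : ℕ) :
    ∫ t, fejerKernel N t ∂(AddCircle.haarAddCircle : Measure UnitAddCircle) ≤ 1 := by
  have h : ((∫ t, fejerKernel N t ∂(AddCircle.haarAddCircle : Measure UnitAddCircle) : ℝ) : ℂ)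
      = (N : ℂ)⁻¹ * N := by
    rw [← integral_complex_ofReal]
    simp only [ofReal_fejerKernel]
    rw [integral_const_mul, integral_finsetSum _ fun j _ => integrable_finsetSum _ fun l _ =>
      integrable_fourier _]
    congr 1
    have h1 : ∀ j ∈ Finset.range N, ∫ t, ∑ l ∈ Finset.range N, fourier ((j : ℤ) - l) t
        ∂(AddCircle.haarAddCircle : Measure UnitAddCircle) = 1 := by
      intro j hj
      rw [integral_finsetSum _ fun l _ => integrable_fourier _]
      simp only [integral_fourier, sub_eq_zero, Nat.cast_inj]
      rw [Finset.sum_ite_eq, if_pos hj]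
    rw [Finset.sum_congr rfl h1]
    simp
  have h' : ∫ t, fejerKernel N t ∂(AddCircle.haarAddCircle : Measure UnitAddCircle)
      = (N : ℝ)⁻¹ * N := Complex.ofReal_injective (by rw [h]; push_cast; rfl)
  rw [h']
  exact inv_mul_le_one

/-- The `n`-th Fourier coefficient, as a linear form on `L¹(𝕋)`. -/
noncomputable def fourierCoeffLin (n : ℤ) : L1T ℂ →ₗ[ℂ] ℂ where
  toFun h := fourierCoeff h n
  map_add' f g := by
    rw [fourierCoeff_congr_ae (Lp.coeFn_add f g),
      fourierCoeff.add (L1.integrable_coeFn f) (L1.integrable_coeFn g), Pi.add_apply]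
  map_smul' c f := by
    rw [fourierCoeff_congr_ae (Lp.coeFn_smul c f), fourierCoeff.const_smul]
    rfl

/-- The Fejér means, on `L¹(𝕋)`. -/
noncomputable def fejerLin (N : ℕ) : L1T ℂ →ₗ[ℂ] L1T ℂ :=
  (N : ℂ)⁻¹ • ∑ j ∈ Finset.range N, ∑ l ∈ Finset.range N,
    (fourierCoeffLin ((j : ℤ) - l)).smulRight (fourierLp 1 ((j : ℤ) - l))

theorem fejerLin_apply (N : ℕ) (h : L1T ℂ) :
    fejerLin N h = (N : ℂ)⁻¹ • ∑ j ∈ Finset.range N, ∑ l ∈ Finset.range N,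
      fourierCoeff h ((j : ℤ) - l) • fourierLp 1 ((j : ℤ) - l) := by
  simp [fejerLin, LinearMap.sum_apply, fourierCoeffLin]

/-- The definition by coefficients makes the finite rank visible; this convolution form, with a
nonnegative kernel, gives contractivity. -/
theorem coeFn_fejerLin (N : ℕ) (h : L1T ℂ) :
    fejerLin N h =ᵐ[AddCircle.haarAddCircle] fun t =>
      ∫ s, h s * (fejerKernel N (t - s) : ℂ) ∂AddCircle.haarAddCircle := by
  have hf : ∀ n : ℤ, (fourierCoeff h n • fourierLp 1 n : L1T ℂ) =ᵐ[AddCircle.haarAddCircle]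
      fun t => ∫ s, h s * fourier n (t - s) ∂AddCircle.haarAddCircle := by
    intro n
    filter_upwards [Lp.coeFn_smul (fourierCoeff h n) (fourierLp 1 n : L1T ℂ),
      coeFn_fourierLp 1 n] with t h1 h2
    rw [h1, Pi.smul_apply, h2, fourierCoeff, smul_eq_mul, ← integral_mul_const]
    refine integral_congr_ae (Eventually.of_forall fun s => ?_)
    have h3 : fourier n (t - s) = fourier n t * fourier (-n) s := by
      simp only [fourier_apply]
      rw [smul_sub, sub_eq_add_neg, AddCircle.toCircle_add, neg_smul]
      simp
    simp only [h3, smul_eq_mul]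
    ring
  have hint : ∀ (n : ℤ) (t : UnitAddCircle), Integrable (fun s => h s * fourier n (t - s))
      AddCircle.haarAddCircle := by
    intro n t
    refine (L1.integrable_coeFn h).mul_bdd (c := 1) ?_ ?_
    · exact Continuous.aestronglyMeasurable (by fun_prop)
    · exact Eventually.of_forall fun s => by rw [fourier_apply, Circle.norm_coe]
  have h1 : ∀ᵐ t ∂(AddCircle.haarAddCircle : Measure UnitAddCircle), ∀ n : ℤ,
      (fourierCoeff h n • fourierLp 1 n : L1T ℂ) t
        = ∫ s, h s * fourier n (t - s) ∂AddCircle.haarAddCircle := ae_all_iff.2 hf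
  have h2 : ∀ᵐ t ∂(AddCircle.haarAddCircle : Measure UnitAddCircle), ∀ j : ℕ,
      (∑ l ∈ Finset.range N, fourierCoeff h ((j : ℤ) - l) • fourierLp 1 ((j : ℤ) - l) : L1T ℂ) t
        = ∑ l ∈ Finset.range N,
          (fourierCoeff h ((j : ℤ) - l) • fourierLp 1 ((j : ℤ) - l) : L1T ℂ) t :=
    ae_all_iff.2 fun j => by
      filter_upwards [Lp.coeFn_finsetSum (Finset.range N) fun l : ℕ =>
        (fourierCoeff h ((j : ℤ) - l) • fourierLp 1 ((j : ℤ) - l) : L1T ℂ)] with t ht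
      rw [ht, Finset.sum_apply]
  rw [fejerLin_apply]
  filter_upwards [h1, h2, Lp.coeFn_smul (N : ℂ)⁻¹ (∑ j ∈ Finset.range N, ∑ l ∈ Finset.range N,
      fourierCoeff h ((j : ℤ) - l) • fourierLp 1 ((j : ℤ) - l) : L1T ℂ),
    Lp.coeFn_finsetSum (Finset.range N) fun j : ℕ => (∑ l ∈ Finset.range N,
      fourierCoeff h ((j : ℤ) - l) • fourierLp 1 ((j : ℤ) - l) : L1T ℂ)] with t h1 h2 h3 h4
  rw [h3, Pi.smul_apply, h4, Finset.sum_apply]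
  simp only [h2, h1, ofReal_fejerKernel]
  rw [smul_eq_mul, ← Finset.sum_congr rfl fun j _ => integral_finsetSum _ fun l _ => hint _ t,
    ← integral_finsetSum _ fun j _ => integrable_finsetSum _ fun l _ => hint _ t,
    ← integral_const_mul]
  refine integral_congr_ae (Eventually.of_forall fun s => ?_)
  simp only [Finset.mul_sum]
  refine Finset.sum_congr rfl fun j _ => Finset.sum_congr rfl fun l _ => ?_
  ring

theorem norm_fejerLin_le (N : ℕ) (h : L1T ℂ) : ‖fejerLin N h‖ ≤ ‖h‖ := by
  have hh := (L1.integrable_coeFn h).norm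
  have hconv := integral_convolution (L := ContinuousLinearMap.mul ℝ ℝ) hh
    (integrable_fejerKernel N)
  have hci := hh.integrable_convolution (ContinuousLinearMap.mul ℝ ℝ) (integrable_fejerKernel N)
  have h1 : ‖fejerLin N h‖ ≤ ∫ t, convolution (fun s => ‖h s‖) (fejerKernel N)
      (ContinuousLinearMap.mul ℝ ℝ) AddCircle.haarAddCircle t ∂AddCircle.haarAddCircle := by
    rw [L1.norm_eq_integral_norm]
    refine integral_mono_ae (L1.integrable_coeFn _).norm hci ?_
    filter_upwards [coeFn_fejerLin N h] with t ht
    rw [ht]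
    refine (norm_integral_le_integral_norm _).trans_eq ?_
    refine integral_congr_ae (Eventually.of_forall fun s => ?_)
    simp [abs_of_nonneg (fejerKernel_nonneg N _)]
  rw [hconv, ContinuousLinearMap.mul_apply', ← L1.norm_eq_integral_norm] at h1
  exact h1.trans (mul_le_of_le_one_right (norm_nonneg _) (integral_fejerKernel_le N))

theorem fourierCoeff_fourierLp_one (m n : ℤ) :
    fourierCoeff (fourierLp 1 m : L1T ℂ) n = if n = m then 1 else 0 := by
  rw [fourierCoeff_congr_ae (coeFn_fourierLp 1 m), fourierCoeff]
  simp only [smul_eq_mul, ← fourier_add, integral_fourier]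
  congr 1
  rw [eq_iff_iff]
  omega

/-- The pairs `j, l < N` with `j - l = d` number `N - d`; truncated subtraction correctly gives 0
when `d ≥ N`. -/
theorem fejerLin_fourierLp (N d : ℕ) : fejerLin N (fourierLp 1 (d : ℤ))
    = ((N : ℂ)⁻¹ * ((N - d : ℕ) : ℂ)) • (fourierLp 1 (d : ℤ) : L1T ℂ) := by
  rw [fejerLin_apply, Finset.sum_comm]
  have h : ∀ l ∈ Finset.range N, ∑ j ∈ Finset.range N,
      fourierCoeff (fourierLp 1 (d : ℤ) : L1T ℂ) ((j : ℤ) - l)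
        • (fourierLp 1 ((j : ℤ) - l) : L1T ℂ)
      = if l < N - d then (fourierLp 1 (d : ℤ) : L1T ℂ) else 0 := by
    intro l _
    rw [Finset.sum_congr rfl (g := fun j : ℕ =>
      if j = l + d then (fourierLp 1 (d : ℤ) : L1T ℂ) else 0), Finset.sum_ite_eq']
    · congr 1
      rw [Finset.mem_range, eq_iff_iff]
      omega
    · intro j _
      rw [fourierCoeff_fourierLp_one]
      by_cases hj : (j : ℤ) - l = d
      · rw [if_pos hj, if_pos (by omega), hj, one_smul]
      · rw [if_neg hj, if_neg (by omega), zero_smul]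
  rw [Finset.sum_congr rfl h, ← Finset.sum_filter, Finset.sum_const, mul_smul]
  congr 1
  have hc : Finset.filter (fun l => l < N - d) (Finset.range N) = Finset.range (N - d) := by
    ext l
    simp only [Finset.mem_filter, Finset.mem_range]
    omega
  rw [hc, Finset.card_range, Nat.cast_smul_eq_nsmul]

theorem monomialVec_eq_smul (k : ℕ) (a : ℂ) :
    monomialVec k a = a • (fourierLp 1 (k : ℤ) : L1T ℂ) := by
  apply Lp.ext
  filter_upwards [coeFn_smulVec (fourierLp 1 (k : ℤ)) a,
    Lp.coeFn_smul a (fourierLp 1 (k : ℤ) : L1T ℂ)] with t h1 h2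
  rw [monomialVec, h1, h2, Pi.smul_apply, smul_eq_mul, smul_eq_mul, mul_comm]

theorem fourierLp_mem_hardyOne (k : ℕ) : (fourierLp 1 (k : ℤ) : L1T ℂ) ∈ hardyOne ℂ := by
  refine Submodule.le_topologicalClosure _ (Submodule.subset_span ⟨(k, 1), ?_⟩)
  simp [monomialVec_eq_smul]

/-- Monomials are eigenvectors, so analytic polynomials are preserved, and continuity extends this
to their closure. -/
theorem fejerLin_mem_hardyOne (N : ℕ) {h : L1T ℂ} (hh : h ∈ hardyOne ℂ) :
    fejerLin N h ∈ hardyOne ℂ := by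
  have hT : analyticPoly ℂ ≤ (analyticPoly ℂ).comap (fejerLin N) := by
    refine Submodule.span_le.2 ?_
    rintro _ ⟨⟨k, a⟩, rfl⟩
    change fejerLin N (monomialVec k a) ∈ analyticPoly ℂ
    rw [monomialVec_eq_smul, map_smul, fejerLin_fourierLp, smul_smul, ← monomialVec_eq_smul]
    exact Submodule.subset_span ⟨(k, _), rfl⟩
  exact map_mem_closure ((fejerLin N).mkContinuous 1 (by simpa using norm_fejerLin_le N)).continuous
    (s := (analyticPoly ℂ : Set (L1T ℂ))) hh fun g hg => hT hg

/-- The Fejér means, on `H¹`. -/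
noncomputable def fejerHardy (N : ℕ) : hardyOne ℂ →ₗ[ℂ] hardyOne ℂ :=
  (fejerLin N).restrict fun _ => fejerLin_mem_hardyOne N

theorem norm_fejerHardy_le (N : ℕ) (h : hardyOne ℂ) : ‖fejerHardy N h‖ ≤ ‖h‖ :=
  norm_fejerLin_le N h.1

instance finiteDimensional_range_fejerHardy (N : ℕ) :
    FiniteDimensional ℂ (LinearMap.range (fejerHardy N)) := by
  let S : Submodule ℂ (L1T ℂ) := Submodule.span ℂ
    (Set.range fun p : Fin N × Fin N => (fourierLp 1 ((p.1 : ℤ) - (p.2 : ℤ)) : L1T ℂ))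
  have hS : FiniteDimensional ℂ S := FiniteDimensional.span_of_finite ℂ (Set.finite_range _)
  have hle : ∀ h, fejerLin N h ∈ S := by
    intro h
    rw [fejerLin_apply]
    refine S.smul_mem _ (S.sum_mem fun j hj => S.sum_mem fun l hl => S.smul_mem _ ?_)
    exact Submodule.subset_span
      ⟨(⟨j, Finset.mem_range.1 hj⟩, ⟨l, Finset.mem_range.1 hl⟩), rfl⟩
  let f : LinearMap.range (fejerHardy N) →ₗ[ℂ] S :=
    ((hardyOne ℂ).subtype ∘ₗ (LinearMap.range (fejerHardy N)).subtype).codRestrict S (by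
      rintro ⟨_, h, rfl⟩
      exact hle h)
  refine FiniteDimensional.of_injective f fun a b hab => ?_
  exact Subtype.ext (Subtype.ext (congrArg (fun z : S => (z : L1T ℂ)) hab))

/-- The monomial `z ^ k`, in `H¹`. -/
noncomputable def hardyMonomial (k : ℕ) : hardyOne ℂ := ⟨fourierLp 1 (k : ℤ), fourierLp_mem_hardyOne k⟩

theorem tendsto_fejerHardy_hardyMonomial (k : ℕ) :
    Tendsto (fun N => fejerHardy N (hardyMonomial k)) atTop (𝓝 (hardyMonomial k)) := by
  have h : ∀ N, fejerHardy N (hardyMonomial k)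
      = ((N : ℂ)⁻¹ * ((N - k : ℕ) : ℂ)) • hardyMonomial k := fun N =>
    Subtype.ext (fejerLin_fourierLp N k)
  simp only [h]
  have hlim : Tendsto (fun N : ℕ => (N : ℂ)⁻¹ * ((N - k : ℕ) : ℂ)) atTop (𝓝 1) := by
    have h1 : Tendsto (fun N : ℕ => 1 - (k : ℂ) * (N : ℂ)⁻¹) atTop (𝓝 (1 - (k : ℂ) * 0)) :=
      (tendsto_inv_atTop_nhds_zero_nat (𝕜 := ℂ)).const_mul _ |>.const_sub _
    rw [mul_zero, sub_zero] at h1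
    refine h1.congr' ?_
    filter_upwards [eventually_ge_atTop (k + 1)] with N hN
    have hN0 : (N : ℂ) ≠ 0 := by exact_mod_cast (by omega : N ≠ 0)
    rw [Nat.cast_sub (by omega)]
    field_simp
  simpa using hlim.smul_const (hardyMonomial k)

/-! ### Transfer to the ultraproduct and surjectivity. -/

theorem norm_le_of_h1ProjConst_lt {X : Type*} [NormedAddCommGroup X] [NormedSpace ℂ X]
    [CompleteSpace X] {R : ℝ≥0} (h : h1ProjConst X < R) (F : ProjTensorCompl (hardyOne ℂ) X) :
    ‖F‖ ≤ R * ‖hardyIncl X F‖ := by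
  obtain ⟨_, ⟨r, rfl, hr⟩, hlt⟩ := sInf_lt_iff.1 h
  refine (hr F).trans ?_
  gcongr
  exact_mod_cast hlt.le

theorem coe_hardyInclAlg_sum_tmul {X : Type*} [NormedAddCommGroup X] [NormedSpace ℂ X] {J : Type*}
    (s : Finset J) (d : J → ℕ) (x : J → X) :
    (hardyInclAlg X (∑ j ∈ s, ProjTensor.tmul (hardyMonomial (d j)) (x j)) : L1T X)
      = ∑ j ∈ s, monomialVec (d j) (x j) := by
  rw [map_sum, Submodule.coe_sum]
  exact Finset.sum_congr rfl fun j _ => congrArg Subtype.val (hardyInclAlg_tmul _ _)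

/-- Bounded projectivity constants control the projective norm of the analytic polynomials with
values in the ultraproduct. -/
theorem norm_sum_hardyMonomial_tmul_le {ι : Type*} (U : Ultrafilter ι) (X : ι → Type*)
    [∀ i, NormedAddCommGroup (X i)] [∀ i, NormedSpace ℂ (X i)] {R : ℝ} (hR : 0 ≤ R)
    (h : ∀ i (u : ProjTensor (hardyOne ℂ) (X i)), ‖u‖ ≤ R * ‖hardyInclAlg (X i) u‖)
    {J : Type*} (s : Finset J) (d : J → ℕ) (x : J → lp X ∞) :
    ‖∑ j ∈ s, ProjTensor.tmul (hardyMonomial (d j))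
        (Submodule.Quotient.mk (x j) : Ultraprod U X)‖ ≤
      2 * R * ‖(∑ j ∈ s, monomialVec (d j) (Submodule.Quotient.mk (x j)) :
        L1T (Ultraprod U X))‖ := by
  set B := ‖(∑ j ∈ s, monomialVec (d j) (Submodule.Quotient.mk (x j)) : L1T (Ultraprod U X))‖
    with hB
  -- The inner `ε` pays for the comparison of `L¹` norms, the outer one makes the bound on the
  -- components strict.
  have key : ∀ ε : ℝ, 0 < ε → ‖∑ j ∈ s, ProjTensor.tmul (hardyMonomial (d j))
      (Submodule.Quotient.mk (x j) : Ultraprod U X)‖ ≤ 2 * (R * (B + ε) + ε) := by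
    intro ε hε
    have hev : ∀ᶠ i in (U : Filter ι),
        ‖∑ j ∈ s, ProjTensor.tmul (hardyMonomial (d j)) (x j i)‖ < R * (B + ε) + ε := by
      filter_upwards [eventually_norm_sum_monomialVec_le U X s d x hε] with i hi
      have h1 := h i (∑ j ∈ s, ProjTensor.tmul (hardyMonomial (d j)) (x j i))
      rw [show ∀ f : hardyOne (X i), ‖f‖ = ‖(f : L1T (X i))‖ from fun _ => rfl,
        coe_hardyInclAlg_sum_tmul] at h1
      have h2 := mul_le_mul_of_nonneg_left hi hR
      linarith
    have hN : ∀ N, ‖∑ j ∈ s, ProjTensor.tmul (fejerHardy N (hardyMonomial (d j)))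
        (Submodule.Quotient.mk (x j) : Ultraprod U X)‖ ≤ 2 * (R * (B + ε) + ε) := fun N =>
      norm_sum_tmul_mk_ultraNull_le U X (fejerHardy N) (norm_fejerHardy_le N) s _ x
        (by positivity) hev
    refine le_of_tendsto (x := atTop) (Tendsto.norm (tendsto_finsetSum _ fun j _ => ?_))
      (Eventually.of_forall hN)
    let T := (ProjTensor.tmulBilin.flip (Submodule.Quotient.mk (x j) : Ultraprod U X)).mkContinuous
      ‖(Submodule.Quotient.mk (x j) : Ultraprod U X)‖
      (fun g : hardyOne ℂ => (ProjTensor.norm_tmul_le g _).trans_eq (mul_comm _ _))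
    exact (T.continuous.tendsto _).comp (tendsto_fejerHardy_hardyMonomial (d j))
  refine le_of_forall_pos_le_add fun ε hε => ?_
  have h1 := key (ε / (2 * (R + 1))) (by positivity)
  have h2 : 2 * (R * (B + ε / (2 * (R + 1))) + ε / (2 * (R + 1))) = 2 * R * B + ε := by
    field_simp
    ring
  linarith

/-- The analytic polynomials are the finite sums of monomials. -/
theorem exists_sum_monomialVec_eq {X : Type*} [NormedAddCommGroup X] [NormedSpace ℂ X] {f : L1T X}
    (hf : f ∈ analyticPoly X) :
    ∃ (s : Finset (ℕ × X)) (x : ℕ × X → X), ∑ p ∈ s, monomialVec p.1 (x p) = f := by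
  obtain ⟨c, rfl⟩ := Finsupp.mem_span_range_iff_exists_finsupp.1 hf
  refine ⟨c.support, fun p => c p • p.2, Finset.sum_congr rfl fun p _ => ?_⟩
  exact congrArg Subtype.val ((hardyBilin X (hardyMonomial p.1)).map_smul (c p) p.2)

/-- If the polynomials have preimages of controlled norm, the space is `H¹`-projective. -/
theorem isH1Projective_of_forall_analyticPoly {X : Type*} [NormedAddCommGroup X] [NormedSpace ℂ X]
    [CompleteSpace X] {C : ℝ} (hC : 0 < C)
    (h : ∀ f ∈ analyticPoly X, ∃ u : ProjTensor (hardyOne ℂ) X,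
      (hardyInclAlg X u : L1T X) = f ∧ ‖u‖ ≤ C * ‖f‖) : IsH1Projective X := by
  let T : NormedAddGroupHom (ProjTensorCompl (hardyOne ℂ) X) (hardyOne X) :=
    (hardyIncl X).toLinearMap.toAddMonoidHom.mkNormedAddGroupHom ‖hardyIncl X‖
      (hardyIncl X).le_opNorm
  let K : AddSubgroup (hardyOne X) :=
    ((analyticPoly X).comap (hardyOne X).subtype).toAddSubgroup
  have hK : T.SurjectiveOnWith K C := by
    intro f hf
    obtain ⟨u, hu, hle⟩ := h f.1 hf
    refine ⟨(u : ProjTensorCompl (hardyOne ℂ) X), ?_, ?_⟩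
    · exact (hardyIncl_coe u).trans (Subtype.ext hu)
    · rw [UniformSpace.Completion.norm_coe]
      exact hle
  intro f
  have hf : f ∈ K.topologicalClosure := by
    change f ∈ closure (Subtype.val ⁻¹' (analyticPoly X : Set (L1T X)))
    rw [closure_subtype, Set.image_preimage_eq_of_subset]
    · exact f.2
    · rw [Subtype.range_coe]
      exact (analyticPoly X).le_topologicalClosure
  -- Successive approximation: `f` is a series of polynomials whose lifts have summable norms.
  obtain ⟨F, hF, -⟩ := controlled_closure_of_complete hC one_pos hK f hf
  exact ⟨F, hF⟩

theorem theorem5p4 {ι : Type*} (X : ι → Type*) [∀ i, NormedAddCommGroup (X i)]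
    [∀ i, NormedSpace ℂ (X i)] [∀ i, CompleteSpace (X i)]
    (hX : ∀ i, IsH1Projective (X i)) (hη : (⨆ i, h1ProjConst (X i)) < ∞) (U : Ultrafilter ι) :
    IsH1Projective (Ultraprod U X) := by
  -- Adding 1 puts `R` strictly above every infimum, so that some admissible constant lies below `R`
  -- whether or not the infimum is attained.
  let R : ℝ≥0 := (⨆ i, h1ProjConst (X i)).toNNReal + 1
  have hR : ∀ i, h1ProjConst (X i) < R := by
    intro i
    refine (le_iSup (fun i => h1ProjConst (X i)) i).trans_lt ?_
    rw [ENNReal.coe_add, ENNReal.coe_toNNReal hη.ne]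
    exact ENNReal.lt_add_right hη.ne (by simp)
  have hle : ∀ i (u : ProjTensor (hardyOne ℂ) (X i)), ‖u‖ ≤ R * ‖hardyInclAlg (X i) u‖ := by
    intro i u
    have h := norm_le_of_h1ProjConst_lt (hR i) (u : ProjTensorCompl (hardyOne ℂ) (X i))
    rwa [hardyIncl_coe, UniformSpace.Completion.norm_coe] at h
  have hR0 : (0 : ℝ) < R := by
    have : (0 : ℝ≥0) < R := by positivity
    exact_mod_cast this
  refine isH1Projective_of_forall_analyticPoly (C := 2 * R) (by positivity) fun f hf => ?_
  obtain ⟨s, y, rfl⟩ := exists_sum_monomialVec_eq hf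
  choose x hx using fun p => Submodule.Quotient.mk_surjective _ (y p)
  obtain rfl : (fun p => Submodule.Quotient.mk (x p)) = y := funext hx
  exact ⟨_, coe_hardyInclAlg_sum_tmul s Prod.fst _,
    norm_sum_hardyMonomial_tmul_le U X hR0.le hle s Prod.fst x⟩
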